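/- Let $G$ be a finite simple graph without isolated vertices. A total dominating set (TDS) of $G$ is a set $S\subseteq V(G)$ such that every vertex of $G$ is adjacent to a vertex in $S$; it is minimal if no proper subset of $S$ is a TDS of $G$. Let $\Gamma_t(G)$ be the maximum cardinality of a minimal TDS of $G$. For a natural number $k$, let $D_k^t(G)$ be the graph whose vertices are the total dominating sets of $G$ of cardinality at most $k$, two of them being adjacent if and only if one is obtained from the other by adding or deleting a single vertex. Let $d_0(G)$ be the smallest integer $\ell$ such that $D_k^t(G)$ is connected for all $k\ge \ell$ (a graph with no vertices is not regarded as connected). Theorem. Let $C_n$ denote the cycle on $n\ge 3$ vertices. Then $d_0(C_8)=\Gamma_t(C_8)+2$, and $d_0(C_n)=\Gamma_t(C_n)+1$ for every $n\ge 3$ with $n\neq 8$. -/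

import Mathlib

namespace TotalDom

/-- `S` is a total dominating set of `G`: every vertex of `G` is adjacent to a vertex in `S`. -/
def IsTDS {V : Type*} (G : SimpleGraph V) (S : Finset V) : Prop :=
  ∀ v : V, ∃ u ∈ S, G.Adj v u

/-- `S` is a minimal total dominating set of `G`: it is a total dominating set and no proper
subset of it is one. -/
def IsMTDS {V : Type*} (G : SimpleGraph V) (S : Finset V) : Prop :=
  IsTDS G S ∧ ∀ T : Finset V, T ⊂ S → ¬ IsTDS G T

/-- The upper total domination number: the maximum cardinality of a minimal total dominating set
of the finite graph `G` (a maximum of a nonempty finite set of naturals as soon as `G` has no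
isolated vertex). -/
noncomputable def upperTotalDomNumber {V : Type*} [Fintype V] (G : SimpleGraph V) : ℕ :=
  sSup {m : ℕ | ∃ S : Finset V, IsMTDS G S ∧ S.card = m}

/-- The `k`-total dominating graph of `G`: its vertices are the total dominating sets of `G` of
cardinality at most `k`; two of them are adjacent iff one is obtained from the other by adding
a single (new) vertex of `G`. -/
def kTotalDomGraph {V : Type*} [DecidableEq V] (G : SimpleGraph V) (k : ℕ) :
    SimpleGraph {S : Finset V // IsTDS G S ∧ S.card ≤ k} where
  Adj S T := (∃ v ∉ S.1, T.1 = insert v S.1) ∨ (∃ v ∉ T.1, S.1 = insert v T.1)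
  symm := ⟨fun _ _ h => h.symm⟩
  loopless := ⟨fun S h => by
    rcases h with ⟨v, hv, h⟩ | ⟨v, hv, h⟩ <;>
    exact hv (h ▸ Finset.mem_insert_self v S.1)⟩

/-- `d₀(G)`: the smallest `ℓ` such that the `k`-total dominating graph of `G` is connected for
all `k ≥ ℓ`. -/
noncomputable def d0 {V : Type*} [DecidableEq V] (G : SimpleGraph V) : ℕ :=
  sInf {l : ℕ | ∀ k : ℕ, l ≤ k → (kTotalDomGraph G k).Connected}

end TotalDom

open Finset

namespace TotalDom

/-! ### Total dominating sets and reachability in a general graph. -/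

section General

variable {V : Type*} {G : SimpleGraph V}

/-! The neighbours of `x + 1` on the cycle are `x` and `x + 2`, so a set is a TDS exactly when its
complement is independent in the graph joining `x` to `x + 2`. That graph is one `n`-cycle for odd
`n` and two `m`-cycles for `n = 2 * m` (single edges if `m = 2`). Think of omitted vertices as
tokens; minimal TDSs are the maximal independent placements.

Lower bound: at level `Γ_t` a largest minimal TDS is isolated (`IsMTDS.not_connected`), and its
rotation by one is a different TDS of the same size.

Upper bound: if `2 * i < m`, any `i` independent tokens on an `m`-cycle can be brought to `evens i`
by moving one token one step at a time (`CyclicIndep.slide_induction`). Lifting a token adds one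
vertex to the TDS, so level `Γ_t + 1` suffices when `i` is the least number of tokens per cycle
(`linked_of_cyclicIndep`). Parity gives `2 * i < m` on odd cycles; for `m ≥ 5` a maximal independent
set through 0 and 3 also gives it.

There remain `m = 2` and `m = 4`, where `2 * i = m` and nothing can slide. On `C_4` a lone token is
lifted and put down on the other vertex. On `C_8` both tokens of a 4-cycle must be lifted at once,
which costs one more level. -/

theorem IsTDS.mono {S T : Finset V} (hS : IsTDS G S) (h : S ⊆ T) : IsTDS G T := fun v =>
  let ⟨u, hu, hv⟩ := hS v
  ⟨u, h hu, hv⟩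

theorem IsTDS.exists_isMTDS {S : Finset V} (hS : IsTDS G S) : ∃ T ⊆ S, IsMTDS G T := by
  induction S using Finset.strongInduction with
  | H S ih =>
    by_cases h : ∃ T, T ⊂ S ∧ IsTDS G T
    · obtain ⟨T, hT, hT'⟩ := h
      obtain ⟨U, hU, hU'⟩ := ih T hT hT'
      exact ⟨U, hU.trans hT.subset, hU'⟩
    · push Not at h
      exact ⟨S, subset_rfl, hS, h⟩

theorem IsMTDS.eq_of_subset {S T : Finset V} (hS : IsMTDS G S) (hT : IsTDS G T) (h : T ⊆ S) :
    T = S := by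
  by_contra hne
  exact hS.2 T (Finset.ssubset_iff_subset_ne.2 ⟨h, hne⟩) hT

theorem IsMTDS.card_le [Fintype V] {S : Finset V} (hS : IsMTDS G S) :
    #S ≤ upperTotalDomNumber G := by
  refine le_csSup ⟨Fintype.card V, ?_⟩ ⟨S, hS, rfl⟩
  rintro m ⟨T, -, rfl⟩
  exact Finset.card_le_univ T

theorem exists_isMTDS_card_eq [Fintype V] {S : Finset V} (hS : IsTDS G S) :
    ∃ T, IsMTDS G T ∧ #T = upperTotalDomNumber G := by
  obtain ⟨T, -, hT⟩ := hS.exists_isMTDS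
  refine Nat.sSup_mem (s := {m : ℕ | ∃ S : Finset V, IsMTDS G S ∧ S.card = m}) ⟨_, T, hT, rfl⟩
    ⟨Fintype.card V, ?_⟩
  rintro m ⟨U, -, rfl⟩
  exact Finset.card_le_univ U

variable [DecidableEq V]

/-- `S` and `T` lie in the same component of the `k`-total dominating graph. -/
def Linked (G : SimpleGraph V) (k : ℕ) (S T : Finset V) : Prop :=
  ∃ (hS : IsTDS G S ∧ #S ≤ k) (hT : IsTDS G T ∧ #T ≤ k),
    (kTotalDomGraph G k).Reachable ⟨S, hS⟩ ⟨T, hT⟩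

theorem Linked.symm {k : ℕ} {S T : Finset V} : Linked G k S T → Linked G k T S :=
  fun ⟨hS, hT, h⟩ => ⟨hT, hS, h.symm⟩

theorem Linked.trans {k : ℕ} {S T U : Finset V} : Linked G k S T → Linked G k T U →
    Linked G k S U :=
  fun ⟨hS, _, h⟩ ⟨_, hU, h'⟩ => ⟨hS, hU, h.trans h'⟩

theorem linked_of_subset {k : ℕ} {S T : Finset V} (hS : IsTDS G S) (h : S ⊆ T) (hT : #T ≤ k) :
    Linked G k S T := by
  induction T using Finset.strongInduction with
  | H T ih =>
    by_cases hST : S = T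
    · subst hST
      exact ⟨⟨hS, hT⟩, ⟨hS, hT⟩, SimpleGraph.Reachable.refl _⟩
    · obtain ⟨v, hvT, hvS⟩ := Finset.exists_of_ssubset (Finset.ssubset_iff_subset_ne.2 ⟨h, hST⟩)
      have h1 : S ⊆ T.erase v := Finset.subset_erase.2 ⟨h, hvS⟩
      obtain ⟨a, b, hab⟩ := ih _ (Finset.erase_ssubset hvT) h1
        ((Finset.card_le_card (Finset.erase_subset _ _)).trans hT)
      refine ⟨a, ⟨hS.mono h, hT⟩, hab.trans (SimpleGraph.Adj.reachable ?_)⟩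
      exact Or.inl ⟨v, Finset.notMem_erase v T, (Finset.insert_erase hvT).symm⟩

theorem linked_of_common_superset {k : ℕ} {S T U : Finset V} (hS : IsTDS G S) (hT : IsTDS G T)
    (hSU : S ⊆ U) (hTU : T ⊆ U) (hU : #U ≤ k) : Linked G k S T :=
  (linked_of_subset hS hSU hU).trans (linked_of_subset hT hTU hU).symm

/-- Every TDS can be shrunk to a minimal one without leaving level `k`, so only minimal ones have to
be linked to `B`. -/
theorem connected_of_linked {k : ℕ} {B : Finset V} (hne : ∃ S, IsTDS G S)
    (h : ∀ S, IsMTDS G S → Linked G k S B) : (kTotalDomGraph G k).Connected := by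
  obtain ⟨S₀, hS₀⟩ := hne
  obtain ⟨T₀, -, hT₀⟩ := hS₀.exists_isMTDS
  obtain ⟨-, hB, -⟩ := h T₀ hT₀
  rw [SimpleGraph.connected_iff_exists_forall_reachable]
  refine ⟨⟨B, hB⟩, fun ⟨S, hS, hSk⟩ => ?_⟩
  obtain ⟨T, hTS, hT⟩ := hS.exists_isMTDS
  obtain ⟨_, _, h⟩ := (linked_of_subset hT.1 hTS hSk).symm.trans (h T hT)
  exact h.symm

theorem not_connected_of_closed {k : ℕ} {A B : Finset V} (P : Finset V → Prop)
    (hA : IsTDS G A ∧ #A ≤ k) (hB : IsTDS G B ∧ #B ≤ k) (hPA : P A) (hPB : ¬ P B)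
    (hP : ∀ S T : {S : Finset V // IsTDS G S ∧ #S ≤ k}, P S.1 →
      (kTotalDomGraph G k).Adj S T → P T.1) :
    ¬ (kTotalDomGraph G k).Connected := by
  intro h
  obtain ⟨w⟩ := h.preconnected ⟨A, hA⟩ ⟨B, hB⟩
  have key : ∀ {X Y : {S : Finset V // IsTDS G S ∧ #S ≤ k}}
      (w : (kTotalDomGraph G k).Walk X Y), P X.1 → P Y.1 := by
    intro X Y w
    induction w with
    | nil => exact id
    | cons h _ ih => exact fun hX => ih (hP _ _ hX h)
  exact hPB (key w hPA)

/-- At level `#S` the set `S` is isolated: there is no room to add a vertex, and minimality forbids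
deleting one. -/
theorem IsMTDS.not_connected {S T : Finset V} (hS : IsMTDS G S) (hT : IsTDS G T)
    (hTS : #T ≤ #S) (hne : T ≠ S) : ¬ (kTotalDomGraph G (#S)).Connected := by
  refine not_connected_of_closed (fun X => X = S) ⟨hS.1, le_rfl⟩ ⟨hT, hTS⟩ rfl hne ?_
  rintro ⟨X, hX⟩ ⟨Y, hY⟩ (rfl : X = S) (⟨v, hv, h⟩ | ⟨v, hv, h⟩)
  · have h : Y = insert v X := h
    have : #Y ≤ #X := hY.2
    have hv : v ∉ X := hv
    rw [h, Finset.card_insert_of_notMem hv] at this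
    omega
  · have h : X = insert v Y := h
    exact hS.eq_of_subset hY.1 (h ▸ Finset.subset_insert v Y)

theorem d0_eq_succ {L : ℕ} (h : ∀ k, L + 1 ≤ k → (kTotalDomGraph G k).Connected)
    (hL : ¬ (kTotalDomGraph G L).Connected) : d0 G = L + 1 := by
  refine le_antisymm (Nat.sInf_le h) (le_csInf ⟨_, h⟩ fun l hl => ?_)
  by_contra hlt
  exact hL (hl L (by omega))

end General

/-! ### Sliding tokens on a cycle. -/

/-- `A` is an independent set of the cycle `0, 1, …, m - 1`. -/
def CyclicIndep (m : ℕ) (A : Finset ℕ) : Prop :=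
  (∀ x ∈ A, x < m) ∧ (∀ x ∈ A, x + 1 ∉ A) ∧ (0 ∈ A → m - 1 ∉ A)

theorem CyclicIndep.mono {m : ℕ} {A B : Finset ℕ} (hB : CyclicIndep m B) (h : A ⊆ B) :
    CyclicIndep m A :=
  ⟨fun x hx => hB.1 x (h hx), fun x hx hx' => hB.2.1 x (h hx) (h hx'),
    fun h0 h1 => hB.2.2 (h h0) (h h1)⟩

/-- The independent set `{0, 2, …, 2 (i - 1)}`. -/
def evens (i : ℕ) : Finset ℕ := (range i).image (2 * ·)

theorem mem_evens {i x : ℕ} : x ∈ evens i ↔ x % 2 = 0 ∧ x < 2 * i := by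
  simp only [evens, mem_image, mem_range]
  exact ⟨by rintro ⟨a, ha, rfl⟩; omega, fun h => ⟨x / 2, by omega, by omega⟩⟩

theorem card_evens (i : ℕ) : #(evens i) = i := by
  rw [evens, card_image_of_injective _ (fun a b h => by simpa using h), card_range]

theorem cyclicIndep_evens {m i : ℕ} (h : 2 * i < m) : CyclicIndep m (evens i) := by
  simp only [CyclicIndep, mem_evens]
  refine ⟨?_, ?_, ?_⟩ <;> intros <;> omega

/-- An independent set none of whose members can be moved one step down is `evens`. -/
theorem CyclicIndep.eq_evens {m i : ℕ} {A : Finset ℕ} (hA : CyclicIndep m A) (hi : #A = i)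
    (him : 2 * i < m)
    (h : ∀ a ∈ A, a = 0 ∨ (a = 1 ∧ m - 1 ∈ A) ∨ (2 ≤ a ∧ a - 2 ∈ A)) : A = evens i := by
  -- A token at 1 can only be blocked by one at `m - 1`; descending from there by twos fills `m / 2`
  -- positions with `m` even, which is too many.
  by_cases h1 : 1 ∈ A
  · exfalso
    have h0 : 0 ∉ A := fun h0 => hA.2.1 0 h0 h1
    have hm : m - 1 ∈ A := by
      rcases h 1 h1 with h | h | h
      · omega
      · exact h.2
      · omega
    have hodd : ∀ a, a ∈ A → a % 2 = 1 := by
      intro a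
      induction a using Nat.strong_induction_on with
      | _ a ih =>
        intro ha
        rcases h a ha with rfl | ⟨rfl, -⟩ | ⟨h2, h3⟩
        · exact absurd ha h0
        · rfl
        · have := ih (a - 2) (by omega) h3
          omega
    have hpar := hodd _ hm
    have hdown : ∀ j, 2 * j < m → m - 1 - 2 * j ∈ A := by
      intro j
      induction j with
      | zero => simpa using fun _ => hm
      | succ j ih =>
        intro hj
        rcases h _ (ih (by omega)) with h | ⟨h, -⟩ | ⟨-, h⟩
        · omega
        · omega
        · rwa [show m - 1 - 2 * (j + 1) = m - 1 - 2 * j - 2 by omega]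
    have hsub : (range (m / 2)).image (fun j => m - 1 - 2 * j) ⊆ A := by
      intro x hx
      obtain ⟨j, hj, rfl⟩ := mem_image.1 hx
      exact hdown j (by have := mem_range.1 hj; omega)
    have := card_le_card hsub
    rw [card_image_of_injOn, card_range] at this
    · omega
    · intro a ha b hb hab
      simp only [coe_range, Set.mem_Iio] at ha hb hab
      omega
  -- Without 1, every chain of blocking tokens descends by twos to 0.
  · have heven : ∀ a, a ∈ A → a % 2 = 0 ∧ ∀ b, 2 * b ≤ a → 2 * b ∈ A := by
      intro a
      induction a using Nat.strong_induction_on with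
      | _ a ih =>
        intro ha
        rcases h a ha with rfl | ⟨rfl, -⟩ | ⟨h2, h3⟩
        · refine ⟨rfl, fun b hb => ?_⟩
          rwa [show b = 0 by omega]
        · exact absurd ha h1
        · obtain ⟨h4, h5⟩ := ih (a - 2) (by omega) h3
          refine ⟨by omega, fun b hb => ?_⟩
          by_cases hb' : 2 * b ≤ a - 2
          · exact h5 b hb'
          · rwa [show 2 * b = a by omega]
    refine eq_of_subset_of_card_le (fun a ha => ?_) (by rw [card_evens, hi])
    obtain ⟨h4, h5⟩ := heven a ha
    have hsub : evens (a / 2 + 1) ⊆ A := by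
      intro x hx
      rw [mem_evens] at hx
      have := h5 (x / 2) (by omega)
      rwa [show 2 * (x / 2) = x by omega] at this
    have := card_le_card hsub
    rw [card_evens] at this
    exact mem_evens.2 ⟨h4, by omega⟩

/-- Induction on the sum of the positions: moving an unblocked token down one step lowers it, and
only `evens i` has no such token. The bound on `#(A ∩ B)` records that one token at most is in the
air during a move. -/
theorem CyclicIndep.slide_induction {m i : ℕ} (him : 2 * i < m) (P : Finset ℕ → Prop)
    (h0 : P (evens i))
    (hs : ∀ A B, CyclicIndep m A → CyclicIndep m B → #A = i → #B = i → i ≤ #(A ∩ B) + 1 →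
      P B → P A)
    {A : Finset ℕ} (hA : CyclicIndep m A) (hi : #A = i) : P A := by
  induction hN : ∑ a ∈ A, a using Nat.strong_induction_on generalizing A with
  | _ N ih =>
    by_cases h : ∀ a ∈ A, a = 0 ∨ (a = 1 ∧ m - 1 ∈ A) ∨ (2 ≤ a ∧ a - 2 ∈ A)
    · rwa [hA.eq_evens hi him h]
    · push Not at h
      obtain ⟨a, ha, hne, h1, h2⟩ := h
      have ha' : a - 1 ∉ A := fun h => hA.2.1 _ h (by rwa [Nat.sub_add_cancel (by omega)])
      have ha'' : a - 1 ∉ A.erase a := fun h => ha' (mem_of_mem_erase h)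
      have hcard : #(insert (a - 1) (A.erase a)) = #A := by
        rw [card_insert_of_notMem ha'', card_erase_add_one ha]
      have hB : CyclicIndep m (insert (a - 1) (A.erase a)) := by
        obtain ⟨hA1, hA2, hA3⟩ := hA
        have ham := hA1 a ha
        refine ⟨fun x hx => ?_, fun x hx hx' => ?_, fun hx hx' => ?_⟩
        · rcases mem_insert.1 hx with rfl | hx
          · omega
          · exact hA1 x (mem_of_mem_erase hx)
        · rcases mem_insert.1 hx with rfl | hx <;> rcases mem_insert.1 hx' with hx' | hx'
          · omega
          · exact (mem_erase.1 hx').1 (by omega)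
          · have hxA := (mem_erase.1 hx).2
            have h3 := h2 (by omega)
            rw [show a - 2 = x by omega] at h3
            exact h3 hxA
          · exact hA2 x (mem_of_mem_erase hx) (mem_of_mem_erase hx')
        · rcases mem_insert.1 hx with hx | hx <;> rcases mem_insert.1 hx' with hx' | hx'
          · omega
          · exact h1 (by omega) (mem_of_mem_erase hx')
          · omega
          · exact hA3 (mem_of_mem_erase hx) (mem_of_mem_erase hx')
      have hsum : ∑ x ∈ insert (a - 1) (A.erase a), x < N := by
        rw [sum_insert ha'']
        have := add_sum_erase A (fun x => x) ha
        omega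
      refine hs A _ hA hB hi (hcard.trans hi) ?_ (ih _ hsum hB (hcard.trans hi) rfl)
      have hsub : A.erase a ⊆ A ∩ insert (a - 1) (A.erase a) :=
        subset_inter (erase_subset _ _) (subset_insert _ _)
      have h3 := card_le_card hsub
      have h4 := card_erase_add_one ha
      omega

/-- An independent set of an `m`-cycle is disjoint from its cyclic shift. -/
theorem CyclicIndep.card_union_succ {m : ℕ} {A : Finset ℕ} (hm : 2 ≤ m) (hA : CyclicIndep m A) :
    #(A ∪ A.image (fun x => if x + 1 = m then 0 else x + 1)) = 2 * #A := by
  obtain ⟨h1, h2, h3⟩ := hA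
  rw [card_union_of_disjoint, card_image_of_injOn, two_mul]
  · intro x hx y hy hxy
    have := h1 x hx
    have := h1 y hy
    simp only at hxy
    split_ifs at hxy <;> omega
  · rw [disjoint_left]
    intro x hx hx'
    obtain ⟨y, hy, rfl⟩ := mem_image.1 hx'
    split_ifs at hx with h
    · exact h3 hx (by rwa [show m - 1 = y by omega])
    · exact h2 y hy hx

theorem CyclicIndep.union_succ_subset {m : ℕ} {A : Finset ℕ} (hm : 2 ≤ m)
    (hA : CyclicIndep m A) :
    A ∪ A.image (fun x => if x + 1 = m then 0 else x + 1) ⊆ range m := by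
  intro x hx
  rw [mem_range]
  rcases mem_union.1 hx with hx | hx
  · exact hA.1 x hx
  · obtain ⟨y, hy, rfl⟩ := mem_image.1 hx
    have := hA.1 y hy
    split_ifs <;> omega

theorem CyclicIndep.two_mul_card_le {m : ℕ} {A : Finset ℕ} (hm : 2 ≤ m) (hA : CyclicIndep m A) :
    2 * #A ≤ m := by
  simpa [hA.card_union_succ hm] using card_le_card (hA.union_succ_subset hm)

/-- The vertex 2 is wasted: 3 keeps it out of `A`, and 0 keeps 1 out of `A`, so 2 is not in the
shift either. -/
theorem CyclicIndep.two_mul_card_lt {m : ℕ} {A : Finset ℕ} (hm : 3 ≤ m) (hA : CyclicIndep m A)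
    (h0 : 0 ∈ A) (h3 : 3 ∈ A) : 2 * #A < m := by
  have h : A ∪ A.image (fun x => if x + 1 = m then 0 else x + 1) ⊆ (range m).erase 2 := by
    refine subset_erase.2 ⟨hA.union_succ_subset (by omega), fun h => ?_⟩
    rcases mem_union.1 h with h | h
    · exact hA.2.1 2 h h3
    · obtain ⟨y, hy, h⟩ := mem_image.1 h
      split_ifs at h
      exact hA.2.1 0 h0 (by rwa [show 0 + 1 = y by omega])
  have := card_le_card h
  rw [hA.card_union_succ (by omega), card_erase_of_mem (by simp; omega), card_range] at this
  omega

/-! ### From independent sets to total dominating sets of cycles. -/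

open SimpleGraph (cycleGraph)

/-- The vertex of the `n`-cycle which is the residue of `x`. -/
def vtx (n : ℕ) [NeZero n] (x : ℕ) : Fin n := ⟨x % n, Nat.mod_lt _ (NeZero.pos n)⟩

/-- `R` is a frozen set of omitted vertices. Surplus tokens are lifted until `i` remain, and these
slide; `hk` leaves room for the intermediate states with `i - 1` tokens. -/
theorem linked_of_cyclicIndep {n k m i : ℕ} {f : ℕ → Fin n} {R : Finset (Fin n)}
    (hf : Set.InjOn f (range m)) (hR : ∀ x < m, f x ∉ R) (him : 2 * i < m)
    (hk : n + 1 ≤ k + i + #R)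
    (hF : ∀ A, CyclicIndep m A → IsTDS (cycleGraph n) (univ \ (A.image f ∪ R)))
    {A : Finset ℕ} (hA : CyclicIndep m A) (hi : i ≤ #A) :
    Linked (cycleGraph n) k (univ \ (A.image f ∪ R)) (univ \ ((evens i).image f ∪ R)) := by
  have hanti : ∀ {A B : Finset ℕ}, A ⊆ B →
      univ \ (B.image f ∪ R) ⊆ univ \ (A.image f ∪ R) := fun h =>
    sdiff_subset_sdiff subset_rfl (union_subset_union_left (image_subset_image h))
  have hcard : ∀ {A : Finset ℕ}, CyclicIndep m A → i ≤ #A + 1 →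
      #(univ \ (A.image f ∪ R)) ≤ k := by
    intro A hA hi
    have h1 : #(A.image f ∪ R) = #A + #R := by
      rw [card_union_of_disjoint, card_image_of_injOn]
      · exact hf.mono fun x hx => by simpa using hA.1 x hx
      · rw [disjoint_left]
        intro v hv
        obtain ⟨x, hx, rfl⟩ := mem_image.1 hv
        exact hR x (hA.1 x hx)
    rw [card_univ_sdiff, h1, Fintype.card_fin]
    omega
  obtain ⟨B, hBA, hB⟩ := exists_subset_card_eq hi
  have hBI := hA.mono hBA
  have hev := cyclicIndep_evens him
  refine (linked_of_subset (hF A hA) (hanti hBA) (hcard hBI (by omega))).trans ?_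
  refine CyclicIndep.slide_induction him
    (fun B => Linked (cycleGraph n) k (univ \ (B.image f ∪ R)) (univ \ ((evens i).image f ∪ R)))
    (linked_of_subset (hF _ hev) subset_rfl (hcard hev (by rw [card_evens]; omega)))
    ?_ hBI hB
  intro C D hC hD hCi hDi hCD h
  exact (linked_of_common_superset (hF C hC) (hF D hD) (hanti inter_subset_left)
    (hanti inter_subset_right) (hcard (hC.mono inter_subset_left) hCD)).trans h

section Cycle

variable {n : ℕ} [NeZero n]

theorem vtx_eq_iff {x y : ℕ} : vtx n x = vtx n y ↔ x ≡ y [MOD n] := by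
  simp [vtx, Nat.ModEq]

theorem vtx_val (v : Fin n) : vtx n v.val = v := by
  ext
  simp [vtx, Nat.mod_eq_of_lt v.2]

theorem vtx_add_self (x : ℕ) : vtx n (x + n) = vtx n x := by
  simp [vtx]

theorem vtx_add (x y : ℕ) : vtx n (x + y) = vtx n x + vtx n y := by
  ext
  simp [vtx, Fin.val_add]

theorem adj_vtx_succ_iff (hn : 2 ≤ n) {x : ℕ} {u : Fin n} :
    (cycleGraph n).Adj (vtx n (x + 1)) u ↔ u = vtx n x ∨ u = vtx n (x + 2) := by
  have h1 : ∀ w : Fin n, w.val = 1 ↔ w = vtx n 1 := fun w => by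
    rw [Fin.ext_iff]
    simp [vtx, Nat.mod_eq_of_lt (show 1 < n by omega)]
  rw [SimpleGraph.cycleGraph_adj', h1, h1, vtx_add x 1, show x + 2 = x + 1 + 1 from rfl,
    vtx_add (x + 1) 1, vtx_add x 1, sub_eq_iff_eq_add, sub_eq_iff_eq_add]
  refine or_congr ⟨fun h => ?_, fun h => by rw [h, add_comm]⟩ (by rw [add_comm (vtx n 1)])
  rw [add_comm] at h
  exact (add_left_cancel h).symm

theorem isTDS_cycleGraph_iff (hn : 2 ≤ n) {S : Finset (Fin n)} :
    IsTDS (cycleGraph n) S ↔ ∀ x, vtx n x ∈ S ∨ vtx n (x + 2) ∈ S := by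
  refine ⟨fun h x => ?_, fun h v => ?_⟩
  · obtain ⟨u, hu, hv⟩ := h (vtx n (x + 1))
    rcases (adj_vtx_succ_iff hn).1 hv with rfl | rfl
    · exact Or.inl hu
    · exact Or.inr hu
  · have hv : v = vtx n (v.val + n - 1 + 1) := by
      rw [show v.val + n - 1 + 1 = v.val + n by omega, vtx_add_self, vtx_val]
    rw [hv]
    rcases h (v.val + n - 1) with h | h
    · exact ⟨_, h, (adj_vtx_succ_iff hn).2 (Or.inl rfl)⟩
    · exact ⟨_, h, (adj_vtx_succ_iff hn).2 (Or.inr rfl)⟩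

theorem isTDS_univ (hn : 2 ≤ n) : IsTDS (cycleGraph n) univ :=
  (isTDS_cycleGraph_iff hn).2 fun _ => Or.inl (mem_univ _)

theorem vtx_ne_vtx_add_two (hn : 3 ≤ n) (x : ℕ) : vtx n x ≠ vtx n (x + 2) := by
  rw [Ne, vtx_eq_iff]
  intro h
  have := (Nat.modEq_iff_dvd' (by omega)).1 h
  rw [show x + 2 - x = 2 by omega] at this
  exact absurd (Nat.le_of_dvd (by omega) this) (by omega)

theorem IsMTDS.exists_notMem (hn : 3 ≤ n) {S : Finset (Fin n)} (hS : IsMTDS (cycleGraph n) S)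
    (x : ℕ) : ∃ y, vtx n y ∉ S := by
  by_contra! h
  -- Erasing one vertex from the whole vertex set leaves a TDS, since it cannot be both `y` and `y +
  -- 2`.
  refine hS.2 (S.erase (vtx n x)) (erase_ssubset (h x)) ((isTDS_cycleGraph_iff (by omega)).2 ?_)
  intro y
  simp only [mem_erase, h, and_true]
  by_contra! h'
  exact vtx_ne_vtx_add_two hn y (h'.1.trans h'.2.symm)

theorem not_connected_upperTotalDomNumber (hn : 3 ≤ n) :
    ¬ (kTotalDomGraph (cycleGraph n) (upperTotalDomNumber (cycleGraph n))).Connected := by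
  obtain ⟨S, hS, hcard⟩ := exists_isMTDS_card_eq (isTDS_univ (n := n) (by omega))
  rw [← hcard]
  have htds := (isTDS_cycleGraph_iff (by omega)).1 hS.1
  have hmem : ∀ x, vtx n x ∈ S.image (· + vtx n 1) ↔ vtx n (x + n - 1) ∈ S := by
    intro x
    have hx : vtx n x = vtx n (x + n - 1) + vtx n 1 := by
      rw [← vtx_add, Nat.sub_add_cancel (by omega), vtx_add_self]
    rw [hx, (add_left_injective (vtx n 1)).mem_finset_image]
  refine hS.not_connected (T := S.image (· + vtx n 1)) ?_ card_image_le fun h => ?_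
  · rw [isTDS_cycleGraph_iff (by omega)]
    intro x
    rw [hmem, hmem, show x + 2 + n - 1 = x + n - 1 + 2 by omega]
    exact htds _
  · rw [h] at hmem
    -- A nonempty rotation-invariant set is the whole vertex set, which is not minimal.
    have hsucc : ∀ x, vtx n x ∈ S → vtx n (x + 1) ∈ S := fun x hx => by
      rw [hmem, show x + 1 + n - 1 = x + n by omega, vtx_add_self]
      exact hx
    obtain ⟨x, hx⟩ : ∃ x, vtx n x ∈ S := (htds 0).elim (fun h => ⟨_, h⟩) (fun h => ⟨_, h⟩)
    have hadd : ∀ j, vtx n (x + j) ∈ S := fun j => by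
      induction j with
      | zero => exact hx
      | succ j ih => exact hsucc _ ih
    obtain ⟨y, hy⟩ := hS.exists_notMem hn 0
    apply hy
    have := hadd (y + (n - 1) * x)
    have hxy : vtx n (x + (y + (n - 1) * x)) = vtx n y := by
      rw [vtx_eq_iff, show x + (y + (n - 1) * x) = y + n * x by
        obtain ⟨k, rfl⟩ : ∃ k, n = k + 1 := ⟨n - 1, by omega⟩
        simp only [Nat.add_sub_cancel]
        ring]
      simp [Nat.ModEq]
    rwa [hxy] at this

/-- The indices `x < m` for which the vertex `2 x + t` is not in `S`. -/
def fibre (m t : ℕ) (S : Finset (Fin n)) : Finset ℕ :=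
  (range m).filter (fun x => vtx n (2 * x + t) ∉ S)

theorem mem_fibre {m t : ℕ} {S : Finset (Fin n)} {x : ℕ} :
    x ∈ fibre m t S ↔ x < m ∧ vtx n (2 * x + t) ∉ S := by
  simp [fibre]

theorem cyclicIndep_fibre (hn : 2 ≤ n) {m t : ℕ} (hm : 1 ≤ m) (hnm : n ∣ 2 * m) {S : Finset (Fin n)}
    (hS : IsTDS (cycleGraph n) S) :
    CyclicIndep m (fibre m t S) := by
  rw [isTDS_cycleGraph_iff hn] at hS
  simp only [CyclicIndep, mem_fibre]
  refine ⟨fun x hx => hx.1, fun x hx hx' => ?_, fun hx hx' => ?_⟩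
  · rcases hS (2 * x + t) with h | h
    · exact hx.2 h
    · exact hx'.2 (by rwa [show 2 * (x + 1) + t = 2 * x + t + 2 by ring])
  · rcases hS (2 * (m - 1) + t) with h | h
    · exact hx'.2 h
    · have h0 : vtx n (2 * m + t) = vtx n (2 * 0 + t) :=
        vtx_eq_iff.2 ((Nat.modEq_zero_iff_dvd.2 hnm).add_right t)
      rw [show 2 * (m - 1) + t + 2 = 2 * m + t by omega, h0] at h
      exact hx.2 h

theorem CyclicIndep.not_both {m t : ℕ} (hm : 2 ≤ m)
    (hinj : ∀ a b, vtx n (2 * a + t) = vtx n (2 * b + t) → a ≡ b [MOD m]) {A : Finset ℕ}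
    (hA : CyclicIndep m A) {x : ℕ} (h1 : vtx n x ∈ A.image (fun a => vtx n (2 * a + t)))
    (h2 : vtx n (x + 2) ∈ A.image (fun a => vtx n (2 * a + t))) : False := by
  obtain ⟨a, ha, hax⟩ := mem_image.1 h1
  obtain ⟨b, hb, hbx⟩ := mem_image.1 h2
  have h : vtx n (2 * b + t) = vtx n (2 * (a + 1) + t) := by
    rw [show 2 * (a + 1) + t = 2 * a + t + 2 by ring, hbx, vtx_add x 2, vtx_add (2 * a + t) 2, hax]
  have h := hinj _ _ h
  have ham := hA.1 a ha
  have hbm := hA.1 b hb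
  unfold Nat.ModEq at h
  rw [Nat.mod_eq_of_lt hbm] at h
  by_cases h' : a + 1 < m
  · rw [Nat.mod_eq_of_lt h'] at h
    exact hA.2.1 a ha (h ▸ hb)
  · rw [show a + 1 = m by omega, Nat.mod_self] at h
    exact hA.2.2 (h ▸ hb) (by rwa [show m - 1 = a by omega])

end Cycle

/-! ### Odd cycles. -/

theorem connected_cycleGraph_of_odd {n k : ℕ} (hn : 3 ≤ n) (hodd : n % 2 = 1)
    (hk : upperTotalDomNumber (cycleGraph n) + 1 ≤ k) :
    (kTotalDomGraph (cycleGraph n) k).Connected := by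
  have : NeZero n := ⟨by omega⟩
  -- Doubling is invertible modulo an odd `n`, so `x ↦ 2 * x` runs once through all vertices.
  have hinj : ∀ a b, vtx n (2 * a + 0) = vtx n (2 * b + 0) → a ≡ b [MOD n] := fun a b h => by
    refine Nat.ModEq.cancel_left_of_coprime (c := 2) ?_ (vtx_eq_iff.1 h)
    exact Nat.Coprime.symm (Nat.coprime_two_left.2 (Nat.odd_iff.2 hodd))
  have hinjOn : Set.InjOn (fun x => vtx n (2 * x + 0)) (range n) := fun a ha b hb h =>
    (hinj a b h).eq_of_lt_of_lt (by simpa using ha) (by simpa using hb)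
  have hsurj : (range n).image (fun x => vtx n (2 * x + 0)) = univ := by
    apply eq_univ_of_card
    rw [card_image_of_injOn hinjOn, card_range, Fintype.card_fin]
  have himage : ∀ S, (fibre n 0 S).image (fun x => vtx n (2 * x + 0)) = Sᶜ := fun S => by
    ext v
    have hv : v ∈ (range n).image (fun x => vtx n (2 * x + 0)) := hsurj ▸ mem_univ v
    obtain ⟨x, hx, rfl⟩ := mem_image.1 hv
    rw [mem_compl]
    refine ⟨fun h => ?_, fun h => mem_image_of_mem _ (mem_fibre.2 ⟨mem_range.1 hx, h⟩)⟩
    obtain ⟨y, hy, hyx⟩ := mem_image.1 h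
    rw [← hyx]
    exact (mem_fibre.1 hy).2
  have hcard : ∀ S : Finset (Fin n), #(fibre n 0 S) + #S = n := fun S => by
    have h1 : #((fibre n 0 S).image (fun x => vtx n (2 * x + 0))) = #(fibre n 0 S) :=
      card_image_of_injOn (hinjOn.mono fun x hx => by
        simpa using (mem_fibre.1 (mem_coe.1 hx)).1)
    rw [← h1, himage, card_compl_add_card, Fintype.card_fin]
  have hind : ∀ S, IsTDS (cycleGraph n) S → CyclicIndep n (fibre n 0 S) := fun S hS =>
    cyclicIndep_fibre (by omega) (by omega) (Dvd.intro_left 2 rfl) hS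
  obtain ⟨S₀, hS₀, hS₀c⟩ := exists_isMTDS_card_eq (isTDS_univ (n := n) (by omega))
  -- A largest minimal TDS omits the fewest vertices. As `n` is odd, this bound is strict, as
  -- sliding requires.
  have h₀ := (hind _ hS₀.1).two_mul_card_le (by omega)
  have h₁ := hcard S₀
  refine connected_of_linked ⟨_, hS₀.1⟩ (fun S hS => ?_)
    (B := univ \ ((evens #(fibre n 0 S₀)).image (fun x => vtx n (2 * x + 0)) ∪ ∅))
  have hS' : univ \ ((fibre n 0 S).image (fun x => vtx n (2 * x + 0)) ∪ ∅) = S := by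
    rw [himage, union_empty, ← compl_eq_univ_sdiff, compl_compl]
  have h₂ := hcard S
  have h₃ := hS.card_le
  have := linked_of_cyclicIndep (k := k) (i := #(fibre n 0 S₀)) (R := ∅) hinjOn
    (fun _ _ => notMem_empty _)
    (by omega) (by rw [card_empty]; omega) (fun A hA => ?_) (hind S hS.1) (by omega)
  · rwa [hS'] at this
  · rw [isTDS_cycleGraph_iff (by omega)]
    intro x
    simp only [union_empty, mem_sdiff, mem_univ, true_and]
    by_contra! h
    exact hA.not_both (by omega) hinj h.1 h.2

/-! ### Even cycles: two independent parity classes. -/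

section Even

variable {m : ℕ} [NeZero (2 * m)]

/-- The set of vertices of the `2 m`-cycle omitting `2 x + t` for `x ∈ A` and `2 x + (1 - t)` for
`x ∈ B`. -/
def omitting (m t : ℕ) [NeZero (2 * m)] (A B : Finset ℕ) : Finset (Fin (2 * m)) :=
  univ \ (A.image (fun x => vtx (2 * m) (2 * x + t)) ∪
    B.image (fun x => vtx (2 * m) (2 * x + (1 - t))))

theorem modEq_of_vtx_eq {t a b : ℕ} (h : vtx (2 * m) (2 * a + t) = vtx (2 * m) (2 * b + t)) :
    a ≡ b [MOD m] :=
  Nat.ModEq.mul_left_cancel' (by omega) (Nat.ModEq.add_right_cancel' t (vtx_eq_iff.1 h))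

theorem eq_of_vtx_eq {t a b : ℕ} (ha : a < m) (hb : b < m)
    (h : vtx (2 * m) (2 * a + t) = vtx (2 * m) (2 * b + t)) : a = b :=
  (modEq_of_vtx_eq h).eq_of_lt_of_lt ha hb

theorem mod_two_eq_of_vtx_eq {x y : ℕ} (h : vtx (2 * m) x = vtx (2 * m) y) : x % 2 = y % 2 :=
  (vtx_eq_iff.1 h).of_mul_right m

theorem exists_vtx_eq {t : ℕ} (ht : t ≤ 1) (v : Fin (2 * m)) :
    ∃ x < m, v = vtx (2 * m) (2 * x + t) ∨ v = vtx (2 * m) (2 * x + (1 - t)) := by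
  have hv := v.2
  refine ⟨v.val / 2, by omega, ?_⟩
  by_cases h : v.val % 2 = t
  · left
    rw [show 2 * (v.val / 2) + t = v.val by omega, vtx_val]
  · right
    rw [show 2 * (v.val / 2) + (1 - t) = v.val by omega, vtx_val]

theorem omitting_symm {t : ℕ} (ht : t ≤ 1) (A B : Finset ℕ) :
    omitting m (1 - t) A B = omitting m t B A := by
  rw [omitting, omitting, union_comm, show 1 - (1 - t) = t by omega]

theorem mem_omitting {t : ℕ} (ht : t ≤ 1) {A B : Finset ℕ} (hA : ∀ x ∈ A, x < m) {x : ℕ}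
    (hx : x < m) : vtx (2 * m) (2 * x + t) ∈ omitting m t A B ↔ x ∉ A := by
  simp only [omitting, mem_sdiff, mem_univ, true_and, mem_union, mem_image, not_or]
  refine ⟨fun h hxA => h.1 ⟨x, hxA, rfl⟩, fun h => ⟨?_, ?_⟩⟩
  · rintro ⟨y, hy, hyx⟩
    exact h (eq_of_vtx_eq (hA y hy) hx hyx ▸ hy)
  · rintro ⟨y, hy, hyx⟩
    have := mod_two_eq_of_vtx_eq hyx
    omega

theorem omitting_fibre {t : ℕ} (ht : t ≤ 1) (S : Finset (Fin (2 * m))) :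
    omitting m t (fibre m t S) (fibre m (1 - t) S) = S := by
  have key : ∀ s ≤ 1, ∀ x < m, vtx (2 * m) (2 * x + s) ∈
      omitting m s (fibre m s S) (fibre m (1 - s) S) ↔ vtx (2 * m) (2 * x + s) ∈ S := by
    intro s hs x hx
    rw [mem_omitting hs (fun x hx => (mem_fibre.1 hx).1) hx, mem_fibre]
    tauto
  ext v
  obtain ⟨x, hx, rfl | rfl⟩ := exists_vtx_eq ht v
  · exact key t ht x hx
  · have := key (1 - t) (by omega) x hx
    rwa [omitting_symm ht, show 1 - (1 - t) = t by omega] at this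

theorem isTDS_omitting {t : ℕ} (ht : t ≤ 1) (hm : 2 ≤ m) {A B : Finset ℕ}
    (hA : CyclicIndep m A) (hB : CyclicIndep m B) :
    IsTDS (cycleGraph (2 * m)) (omitting m t A B) := by
  rw [isTDS_cycleGraph_iff (by omega)]
  intro x
  simp only [omitting, mem_sdiff, mem_univ, true_and, mem_union]
  by_contra! h
  have hpar : ∀ {s : ℕ} {C : Finset ℕ} {y : ℕ},
      vtx (2 * m) y ∈ C.image (fun x => vtx (2 * m) (2 * x + s)) → y % 2 = s % 2 := by
    intro s C y hy
    obtain ⟨z, -, hz⟩ := mem_image.1 hy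
    have := mod_two_eq_of_vtx_eq hz
    omega
  rcases h with ⟨h1 | h1, h2 | h2⟩
  · exact hA.not_both hm (fun _ _ => modEq_of_vtx_eq) h1 h2
  · have := hpar h1
    have := hpar h2
    omega
  · have := hpar h1
    have := hpar h2
    omega
  · exact hB.not_both hm (fun _ _ => modEq_of_vtx_eq) h1 h2

theorem injOn_vtx (m t : ℕ) [NeZero (2 * m)] :
    Set.InjOn (fun x => vtx (2 * m) (2 * x + t)) (range m) :=
  fun _ ha _ hb h => eq_of_vtx_eq (by simpa using ha) (by simpa using hb) h

theorem card_image_vtx (t : ℕ) {A : Finset ℕ} (hA : ∀ x ∈ A, x < m) :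
    #(A.image (fun x => vtx (2 * m) (2 * x + t))) = #A :=
  card_image_of_injOn ((injOn_vtx m t).mono fun x hx => by simpa using hA x hx)

theorem card_omitting {t : ℕ} (ht : t ≤ 1) {A B : Finset ℕ} (hA : ∀ x ∈ A, x < m)
    (hB : ∀ x ∈ B, x < m) : #(omitting m t A B) + #A + #B = 2 * m := by
  have h : #(A.image (fun x => vtx (2 * m) (2 * x + t)) ∪
      B.image (fun x => vtx (2 * m) (2 * x + (1 - t)))) = #A + #B := by
    rw [card_union_of_disjoint, card_image_vtx _ hA, card_image_vtx _ hB]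
    rw [disjoint_left]
    intro v h1 h2
    obtain ⟨a, -, rfl⟩ := mem_image.1 h1
    obtain ⟨b, -, hb⟩ := mem_image.1 h2
    have := mod_two_eq_of_vtx_eq hb
    omega
  have h' := card_sdiff_add_card_eq_card (subset_univ
    (A.image (fun x => vtx (2 * m) (2 * x + t)) ∪
      B.image (fun x => vtx (2 * m) (2 * x + (1 - t)))))
  rw [h, card_univ, Fintype.card_fin] at h'
  rw [omitting]
  omega

theorem omitting_anti {t : ℕ} {A A' B B' : Finset ℕ} (hA : A ⊆ A') (hB : B ⊆ B') :
    omitting m t A' B' ⊆ omitting m t A B :=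
  sdiff_subset_sdiff subset_rfl (union_subset_union (image_subset_image hA)
    (image_subset_image hB))

/-- Otherwise one more vertex could be omitted, contradicting minimality. -/
theorem IsMTDS.not_cyclicIndep_insert {t : ℕ} (ht : t ≤ 1) (hm : 2 ≤ m)
    {S : Finset (Fin (2 * m))} (hS : IsMTDS (cycleGraph (2 * m)) S) {x : ℕ} (hx : x < m)
    (hxS : x ∉ fibre m t S) : ¬ CyclicIndep m (insert x (fibre m t S)) := by
  intro h
  have hB : CyclicIndep m (fibre m (1 - t) S) :=
    cyclicIndep_fibre (by omega) (by omega) dvd_rfl hS.1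
  have h1 := hS.eq_of_subset (isTDS_omitting ht hm h hB)
    ((omitting_anti (subset_insert _ _) subset_rfl).trans (omitting_fibre ht S).subset)
  have h2 := mem_omitting ht h.1 hx (B := fibre m (1 - t) S)
  rw [h1] at h2
  rw [mem_fibre] at hxS
  have h3 : vtx (2 * m) (2 * x + t) ∈ S := by tauto
  exact h2.1 h3 (mem_insert_self _ _)

/-- A TDS inside `omitting m 0 A B` has fibres containing `A` and `B`; maximality leaves no room for
them to grow. -/
theorem isMTDS_omitting (hm : 2 ≤ m) {A B : Finset ℕ} (hA : CyclicIndep m A)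
    (hAm : ∀ x < m, x ∉ A → ¬ CyclicIndep m (insert x A)) (hB : CyclicIndep m B)
    (hBm : ∀ x < m, x ∉ B → ¬ CyclicIndep m (insert x B)) :
    IsMTDS (cycleGraph (2 * m)) (omitting m 0 A B) := by
  have key : ∀ {s : ℕ} {C D : Finset ℕ}, s ≤ 1 → CyclicIndep m C →
      (∀ x < m, x ∉ C → ¬ CyclicIndep m (insert x C)) → ∀ T ⊆ omitting m s C D,
      IsTDS (cycleGraph (2 * m)) T → ∀ x < m, vtx (2 * m) (2 * x + s) ∈ omitting m s C D →
      vtx (2 * m) (2 * x + s) ∈ T := by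
    intro s C D hs hC hCm T hTs hT x hx hxC
    by_contra hxT
    rw [mem_omitting hs hC.1 hx] at hxC
    refine hCm x hx hxC ((cyclicIndep_fibre (t := s) (by omega) (by omega) dvd_rfl hT).mono ?_)
    refine insert_subset (mem_fibre.2 ⟨hx, hxT⟩) fun y hy => mem_fibre.2 ⟨hC.1 y hy, fun h => ?_⟩
    exact (mem_omitting hs hC.1 (hC.1 y hy)).1 (hTs h) hy
  refine ⟨isTDS_omitting (by omega) hm hA hB, fun T hTs hT => hTs.2 fun v hv => ?_⟩
  obtain ⟨x, hx, rfl | rfl⟩ := exists_vtx_eq (t := 0) (by omega) v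
  · exact key (by omega) hA hAm T hTs.1 hT x hx hv
  · have h : omitting m 0 A B = omitting m 1 B A := (omitting_symm (t := 0) (by omega) B A).symm
    rw [h] at hv hTs
    exact key le_rfl hB hBm T hTs.1 hT x hx hv

/-- Each of the two parity classes omits at least half as many vertices as any minimal total
dominating set must. -/
theorem IsMTDS.le_card_fibre {t : ℕ} (ht : t ≤ 1) (hm : 2 ≤ m) {S : Finset (Fin (2 * m))}
    (hS : IsMTDS (cycleGraph (2 * m)) S) :
    2 * m ≤ upperTotalDomNumber (cycleGraph (2 * m)) + 2 * #(fibre m t S) := by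
  have hA : CyclicIndep m (fibre m t S) := cyclicIndep_fibre (by omega) (by omega) dvd_rfl hS.1
  have hAm := fun x hx => hS.not_cyclicIndep_insert ht hm (x := x) hx
  -- Using the same maximal independent set in both classes gives a minimal TDS, whose size is at
  -- most `Γ_t`.
  have h1 := (isMTDS_omitting hm hA hAm hA hAm).card_le
  have h2 := card_omitting (t := 0) (by omega) hA.1 hA.1
  omega

theorem linked_omitting {t i k : ℕ} (ht : t ≤ 1) (hm : 2 ≤ m) {A B : Finset ℕ}
    (hA : CyclicIndep m A) (hB : CyclicIndep m B) (him : 2 * i < m) (hiA : i ≤ #A)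
    (hiB : i ≤ #B) (hk : 2 * m + 1 ≤ k + 2 * i) :
    Linked (cycleGraph (2 * m)) k (omitting m t A B) (omitting m t (evens i) B) := by
  refine linked_of_cyclicIndep (f := fun x => vtx (2 * m) (2 * x + t)) (injOn_vtx m t) ?_ him ?_
    (fun C hC => isTDS_omitting ht hm hC hB) hA hiA
  · intro x hx h
    obtain ⟨y, -, hy⟩ := mem_image.1 h
    have := mod_two_eq_of_vtx_eq hy
    omega
  · rw [card_image_vtx _ hB.1]
    omega

theorem connected_cycleGraph_two_mul {k : ℕ} (hm : m = 3 ∨ 5 ≤ m)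
    (hk : upperTotalDomNumber (cycleGraph (2 * m)) + 1 ≤ k) :
    (kTotalDomGraph (cycleGraph (2 * m)) k).Connected := by
  have hfib : ∀ (t : ℕ) (S), IsMTDS (cycleGraph (2 * m)) S → CyclicIndep m (fibre m t S) :=
    fun t S hS => cyclicIndep_fibre (by omega) (by omega) dvd_rfl hS.1
  -- Half of `2 * m - Γ_t`, rounded up: by integrality still a lower bound for every fibre, and
  -- large enough for a slide at level `Γ_t + 1`.
  obtain ⟨i, hi⟩ : ∃ i, i = (2 * m + 1 - upperTotalDomNumber (cycleGraph (2 * m))) / 2 :=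
    ⟨_, rfl⟩
  have hifib : ∀ t ≤ 1, ∀ S, IsMTDS (cycleGraph (2 * m)) S → i ≤ #(fibre m t S) := by
    intro t ht S hS
    have := hS.le_card_fibre ht (by omega)
    omega
  have him : 2 * i < m := by
    rcases hm with rfl | hm
    · obtain ⟨T, -, hT⟩ := (isTDS_univ (n := 2 * 3) (by omega)).exists_isMTDS
      have := hifib 0 (by omega) T hT
      have := (hfib 0 T hT).two_mul_card_le (by omega)
      omega
    -- A minimal TDS omitting 0 and 3 (as indices in a parity class) has a fibre of fewer than `m /
    -- 2` elements.
    · have h03 : CyclicIndep m {0, 3} := by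
        simp only [CyclicIndep, mem_insert, mem_singleton]
        refine ⟨?_, ?_, ?_⟩ <;> intros <;> omega
      obtain ⟨T, hTS, hT⟩ :=
        (isTDS_omitting (t := 0) (by omega) (by omega) h03 h03).exists_isMTDS
      have hmem : ∀ x ∈ ({0, 3} : Finset ℕ), x ∈ fibre m 0 T := fun x hx =>
        mem_fibre.2 ⟨h03.1 x hx, fun h =>
          (mem_omitting (by omega) h03.1 (h03.1 x hx)).1 (hTS h) hx⟩
      have := hifib 0 (by omega) T hT
      have := (hfib 0 T hT).two_mul_card_lt (by omega) (hmem 0 (by simp)) (hmem 3 (by simp))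
      omega
  refine connected_of_linked ⟨_, isTDS_univ (by omega)⟩ (fun S hS => ?_)
    (B := omitting m 1 (evens i) (evens i))
  -- One class slides while the other is frozen, then the roles are exchanged.
  have h0 := linked_omitting (t := 0) (k := k) (by omega) (by omega) (hfib 0 S hS) (hfib 1 S hS)
    him (hifib 0 (by omega) S hS) (hifib 1 (by omega) S hS) (by omega)
  have h1 := linked_omitting (t := 1) (k := k) (by omega) (by omega) (hfib 1 S hS)
    (cyclicIndep_evens him) him (hifib 1 (by omega) S hS) (card_evens i).ge (by omega)
  have hS' := omitting_fibre (t := 0) (by omega) S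
  simp only [Nat.sub_zero] at hS'
  have hsw : omitting m 1 (fibre m 1 S) (evens i) = omitting m 0 (evens i) (fibre m 1 S) :=
    omitting_symm (t := 0) (by omega) _ _
  rw [hS'] at h0
  rw [hsw] at h1
  exact h0.trans h1

end Even

/-! ### The cycles of length 4 and 8. -/

theorem isTDS_cycleGraph_iff_fin {n : ℕ} {S : Finset (Fin (n + 3))} :
    IsTDS (cycleGraph (n + 3)) S ↔ ∀ v, v ∈ S ∨ v + 2 ∈ S := by
  have h2 : vtx (n + 3) 2 = 2 := by
    ext
    simp [vtx]
  rw [isTDS_cycleGraph_iff (by omega)]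
  simp only [vtx_add, h2]
  refine ⟨fun h v => ?_, fun h x => h _⟩
  simpa [vtx_val] using h v.val

theorem upperTotalDomNumber_eq {V : Type*} [Fintype V] {G : SimpleGraph V} {c : ℕ}
    (hne : ∃ S, IsTDS G S) (h : ∀ S, IsMTDS G S → #S = c) : upperTotalDomNumber G = c := by
  obtain ⟨S, hS⟩ := hne
  obtain ⟨T, hT, hTc⟩ := exists_isMTDS_card_eq hS
  rw [← hTc, h T hT]

theorem IsMTDS.mem_of_cycleGraph_four {S : Finset (Fin 4)} (hS : IsMTDS (cycleGraph 4) S) :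
    S ∈ ({{0, 1}, {0, 3}, {2, 1}, {2, 3}} : Finset (Finset (Fin 4))) := by
  have h := isTDS_cycleGraph_iff_fin.1 hS.1
  have key : ∃ W ∈ ({{0, 1}, {0, 3}, {2, 1}, {2, 3}} : Finset (Finset (Fin 4))), W ⊆ S := by
    have h0 : (0 : Fin 4) ∈ S ∨ (2 : Fin 4) ∈ S := h 0
    have h1 : (1 : Fin 4) ∈ S ∨ (3 : Fin 4) ∈ S := h 1
    simp only [mem_insert, mem_singleton, exists_eq_or_imp, exists_eq_left, insert_subset_iff,
      singleton_subset_iff]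
    tauto
  obtain ⟨W, hW, hWS⟩ := key
  have hWt : IsTDS (cycleGraph 4) W := by
    rw [isTDS_cycleGraph_iff_fin]
    clear hWS
    revert W
    decide
  rwa [← hS.eq_of_subset hWt hWS]

theorem upperTotalDomNumber_cycleGraph_four : upperTotalDomNumber (cycleGraph 4) = 2 := by
  refine upperTotalDomNumber_eq ⟨_, isTDS_univ (by omega)⟩ fun S hS => ?_
  have := hS.mem_of_cycleGraph_four
  simp only [mem_insert, mem_singleton] at this
  rcases this with rfl | rfl | rfl | rfl <;> rfl

/-- Minimal sets agreeing on a parity class have a union of at most 3 vertices; `{2, 3}` reaches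
`{0, 1}` through `{0, 3}`. -/
theorem connected_cycleGraph_four {k : ℕ} (hk : 3 ≤ k) :
    (kTotalDomGraph (cycleGraph 4) k).Connected := by
  refine connected_of_linked ⟨_, isTDS_univ (by omega)⟩ (B := {0, 1}) fun S hS => ?_
  have hlink : ∀ A B : Finset (Fin 4), (∀ v, v ∈ A ∨ v + 2 ∈ A) → (∀ v, v ∈ B ∨ v + 2 ∈ B) →
      #(A ∪ B) ≤ 3 → Linked (cycleGraph 4) k A B := fun A B hA hB hAB =>
    linked_of_common_superset (isTDS_cycleGraph_iff_fin.2 hA) (isTDS_cycleGraph_iff_fin.2 hB)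
      subset_union_left subset_union_right (hAB.trans hk)
  have hmem := hS.mem_of_cycleGraph_four
  simp only [mem_insert, mem_singleton] at hmem
  rcases hmem with rfl | rfl | rfl | rfl
  · exact hlink _ _ (by decide) (by decide) (by decide)
  · exact hlink _ _ (by decide) (by decide) (by decide)
  · exact hlink _ _ (by decide) (by decide) (by decide)
  · exact (hlink _ {0, 3} (by decide) (by decide) (by decide)).trans
      (hlink _ _ (by decide) (by decide) (by decide))

/-- The maximal independent sets of a 4-cycle are its two opposite pairs, so there are two choices
in each parity class. -/
theorem IsMTDS.mem_of_cycleGraph_eight {S : Finset (Fin 8)} (hS : IsMTDS (cycleGraph 8) S) :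
    S ∈ ({{0, 4, 1, 5}, {0, 4, 3, 7}, {2, 6, 1, 5}, {2, 6, 3, 7}} : Finset (Finset (Fin 8))) := by
  have h := isTDS_cycleGraph_iff_fin.1 hS.1
  have key : ∃ W ∈ ({{0, 4, 1, 5}, {0, 4, 3, 7}, {2, 6, 1, 5}, {2, 6, 3, 7}} :
      Finset (Finset (Fin 8))), W ⊆ S := by
    have h0 : (0 : Fin 8) ∈ S ∨ (2 : Fin 8) ∈ S := h 0
    have h1 : (1 : Fin 8) ∈ S ∨ (3 : Fin 8) ∈ S := h 1
    have h2 : (2 : Fin 8) ∈ S ∨ (4 : Fin 8) ∈ S := h 2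
    have h3 : (3 : Fin 8) ∈ S ∨ (5 : Fin 8) ∈ S := h 3
    have h4 : (4 : Fin 8) ∈ S ∨ (6 : Fin 8) ∈ S := h 4
    have h5 : (5 : Fin 8) ∈ S ∨ (7 : Fin 8) ∈ S := h 5
    have h6 : (6 : Fin 8) ∈ S ∨ (0 : Fin 8) ∈ S := h 6
    have h7 : (7 : Fin 8) ∈ S ∨ (1 : Fin 8) ∈ S := h 7
    simp only [mem_insert, mem_singleton, exists_eq_or_imp, exists_eq_left, insert_subset_iff,
      singleton_subset_iff]
    grind
  obtain ⟨W, hW, hWS⟩ := key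
  have hWt : IsTDS (cycleGraph 8) W := by
    rw [isTDS_cycleGraph_iff_fin]
    simp only [mem_insert, mem_singleton] at hW
    rcases hW with rfl | rfl | rfl | rfl <;> decide
  rwa [← hS.eq_of_subset hWt hWS]

theorem upperTotalDomNumber_cycleGraph_eight : upperTotalDomNumber (cycleGraph 8) = 4 := by
  refine upperTotalDomNumber_eq ⟨_, isTDS_univ (by omega)⟩ fun S hS => ?_
  have := hS.mem_of_cycleGraph_eight
  simp only [mem_insert, mem_singleton] at this
  rcases this with rfl | rfl | rfl | rfl <;> rfl

/-- Changing the pair in one parity class passes through a union of 6 vertices. -/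
theorem connected_cycleGraph_eight {k : ℕ} (hk : 6 ≤ k) :
    (kTotalDomGraph (cycleGraph 8) k).Connected := by
  refine connected_of_linked ⟨_, isTDS_univ (by omega)⟩ (B := {0, 4, 1, 5}) fun S hS => ?_
  have hlink : ∀ A B : Finset (Fin 8), (∀ v, v ∈ A ∨ v + 2 ∈ A) → (∀ v, v ∈ B ∨ v + 2 ∈ B) →
      #(A ∪ B) ≤ 6 → Linked (cycleGraph 8) k A B := fun A B hA hB hAB =>
    linked_of_common_superset (isTDS_cycleGraph_iff_fin.2 hA) (isTDS_cycleGraph_iff_fin.2 hB)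
      subset_union_left subset_union_right (hAB.trans hk)
  have hmem := hS.mem_of_cycleGraph_eight
  simp only [mem_insert, mem_singleton] at hmem
  rcases hmem with rfl | rfl | rfl | rfl
  · exact hlink _ _ (by decide) (by decide) (by decide)
  · exact hlink _ _ (by decide) (by decide) (by decide)
  · exact hlink _ _ (by decide) (by decide) (by decide)
  · exact (hlink _ {0, 4, 3, 7} (by decide) (by decide) (by decide)).trans
      (hlink _ _ (by decide) (by decide) (by decide))

theorem not_connected_cycleGraph_eight : ¬ (kTotalDomGraph (cycleGraph 8) 5).Connected := by
  refine not_connected_of_closed (fun S => ({0, 4, 1, 5} : Finset (Fin 8)) ⊆ S)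
    (A := {0, 4, 1, 5}) (B := {2, 6, 3, 7})
    ⟨isTDS_cycleGraph_iff_fin.2 (by decide), by decide⟩
    ⟨isTDS_cycleGraph_iff_fin.2 (by decide), by decide⟩ subset_rfl (by decide) ?_
  rintro ⟨S, hS, hSc⟩ ⟨T, hT, hTc⟩ (hPS : _ ⊆ S) (⟨v, hv, h⟩ | ⟨v, hv, h⟩)
  · have h : T = insert v S := h
    exact hPS.trans (h ▸ subset_insert v S)
  · have h : S = insert v T := h
    have hv : v ∉ T := hv
    change _ ⊆ T
    rw [isTDS_cycleGraph_iff_fin] at hT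
    by_contra hnot
    have hvA : v ∈ ({0, 4, 1, 5} : Finset (Fin 8)) := by
      by_contra hvA
      exact hnot ((subset_insert_iff_of_notMem hvA).1 (h ▸ hPS))
    -- Deleting `v` requires `v + 2` and `v - 2 = v + 6` to be present; neither lies in `{0, 4, 1,
    -- 5}`, so `S` would have at least 6 elements.
    have h1 : v + 2 ∈ S := h ▸ mem_insert_of_mem ((hT v).resolve_left hv)
    have h2 : v + 6 ∈ S := by
      have hv8 : v + 6 + 2 = v := by rw [add_assoc]; exact add_zero v
      exact h ▸ mem_insert_of_mem ((hT (v + 6)).resolve_right (hv8.symm ▸ hv))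
    have hsub : insert (v + 2) (insert (v + 6) {0, 4, 1, 5}) ⊆ S :=
      insert_subset h1 (insert_subset h2 hPS)
    have hcard := (card_le_card hsub).trans hSc
    revert hcard hvA
    clear * -
    revert v
    decide

end TotalDom

theorem theorem3p6 :
    TotalDom.d0 (SimpleGraph.cycleGraph 8) =
      TotalDom.upperTotalDomNumber (SimpleGraph.cycleGraph 8) + 2 ∧
    ∀ n : ℕ, 3 ≤ n → n ≠ 8 →
      TotalDom.d0 (SimpleGraph.cycleGraph n) =
        TotalDom.upperTotalDomNumber (SimpleGraph.cycleGraph n) + 1 := by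
  refine ⟨?_, fun n hn h8 => ?_⟩
  · rw [TotalDom.upperTotalDomNumber_cycleGraph_eight]
    exact TotalDom.d0_eq_succ (fun _ => TotalDom.connected_cycleGraph_eight)
      TotalDom.not_connected_cycleGraph_eight
  · have : NeZero n := ⟨by omega⟩
    refine TotalDom.d0_eq_succ (fun k hk => ?_) (TotalDom.not_connected_upperTotalDomNumber hn)
    rcases Nat.even_or_odd' n with ⟨m, rfl | hodd⟩
    · by_cases h4 : m = 2
      · subst h4
        exact TotalDom.connected_cycleGraph_four
          (by rwa [TotalDom.upperTotalDomNumber_cycleGraph_four] at hk)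
      · exact TotalDom.connected_cycleGraph_two_mul (by omega) hk
    · exact TotalDom.connected_cycleGraph_of_odd hn (by omega) hk
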